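/- **Theorem.** Consider Bell-type measurement scenarios: finitely many parties $j=1,\dots,N$, a finite set $M_j$ of measurements for each party, and a family $\mathcal M$ of contexts covering $\mathcal X=\bigsqcup_j M_j$, each context $C=\{m_1,\dots,m_N\}$ consisting of one measurement of each party. A (no-signalling) empirical model with outcome set $O$ is a family of probability distributions $(\zeta_C)_{C\in\mathcal M}$ with $\zeta_C$ on $O^C$ (if $O$ is infinite, of finite support), whose marginals on $C\cap C'$ agree for all $C,C'\in\mathcal M$. It is *quantum realisable* (for $O$ finite) if there are finite-dimensional Hilbert spaces $H_j$, a density operator $\rho$ on $\bigotimes_j H_j$ and POVMs $(E_j^{m}(o))_{o\in O}$ on $H_j$, for $m\in M_j$, with $\zeta_C(o)=\operatorname{Tr}\big[\rho\,\bigotimes_j E_j^{m_j}(o_j)\big]$ for every $C=\{m_1,\dots,m_N\}\in\mathcal M$ and $o\in O^C$. If $R$ is a commutative ring and the outcome set is an $R$-module $G$, the model is *$\mathrm{AvN}_{R,G}$* if there is no $s:\mathcal X\to G$ such that, for every $C\in\mathcal M$, $s|_C$ satisfies every equation $\sum_{x\in C} r_x s_x=b$ ($r_x\in R$, $b\in G$)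 that is satisfied by all elements of the support of $\zeta_C$; and $\mathrm{AvN}_R$ means $\mathrm{AvN}_{R,R}$. For a family of maps $e=(e_x:O\to G)_{x\in\mathcal X}$, the model *relabelled by $e$* is the push-forward of $(\zeta_C)_C$ along $(o_x)_{x\in C}\mapsto (e_x(o_x))_{x\in C}$. For each $n\ge 2$ there is a quantum-realisable empirical model with outcome set $\mathbb Z_n$ which is $\mathrm{AvN}_{\mathbb Z_n}$ and $\mathrm{AvN}_{\mathbb Z,\mathbb Z_n}$, but which is not $\mathrm{AvN}_{\mathbb Z_m,K'}$ for any $m\ge 2$ coprime to $n$ and any non-trivial abelian group $K'$ whose exponent divides $m$, under any labelling of its outcomes by elements of $K'$: for all families of maps $e_x:\mathbb Z_n\to K'$ (not necessarily injective, possibly depending on the measurement $x$), the relabelled model is not $\mathrm{AvN}_{\mathbb Z_m,K'}$. In particular, under no labelling of its outcomes by elements of $\mathbb Z_m$ is it $\mathrm{AvN}_{\mathbb Z_m}$. Hence the hierarchy of quantum-realisable AvN models over the rings of modular integers does not collapse: for any coprime $n,m\ge 2$ there is a quantum-realisable $\mathrm{AvN}_{\mathbb Z_n}$ model which is not, under any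 labelling of its outcomes, $\mathrm{AvN}_{\mathbb Z_m}$. -/

import Mathlib

open scoped NNReal ComplexOrder

noncomputable section

/-! ## Distributions over a commutative semiring -/

/-- `R`-distributions on `α`: finitely supported functions `α → R` with total weight `1`. -/
@[ext]
structure RDist (R : Type*) [CommSemiring R] (α : Type*) where
  weight : α →₀ R
  total : (weight.sum fun _ r => r) = 1

namespace RDist

variable {R R' : Type*} [CommSemiring R] [CommSemiring R'] {α β γ : Type*}

/-- The support of a distribution. -/
def support (d : RDist R α) : Set α := {a | d.weight a ≠ 0}

/-- Push-forward along `f`: the weight of `b` is the sum of the weights of all `a` with `f a = b`. -/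
def map (f : α → β) (d : RDist R α) : RDist R β :=
  ⟨d.weight.mapDomain f, by
    rw [Finsupp.sum_mapDomain_index (fun _ => rfl) (fun _ _ _ => rfl), d.total]⟩

theorem map_map (f : α → β) (g : β → γ) (d : RDist R α) :
    (d.map f).map g = d.map (g ∘ f) :=
  RDist.ext Finsupp.mapDomain_comp.symm

/-- Change of semiring along a homomorphism `r`: the distribution `r ∘ d`. -/
def changeSemiring (r : R →+* R') (d : RDist R α) : RDist R' α :=
  ⟨d.weight.mapRange r (map_zero r), by
    rw [Finsupp.sum_mapRange_index (fun _ => rfl), Finsupp.sum, ← map_sum]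
    exact (congrArg r d.total).trans (map_one r)⟩

theorem changeSemiring_map (r : R →+* R') (f : α → β) (d : RDist R α) :
    (d.map f).changeSemiring r = (d.changeSemiring r).map f :=
  RDist.ext (Finsupp.mapDomain_mapRange f d.weight r (map_zero r) (map_add r)).symm

end RDist

/-- The semiring of booleans `({0,1}, or, 0, and, 1)`. (Mathlib's ring structure on `Bool` has
`xor` as its addition and is not used here.) -/
def Possibility : Type := Bool

namespace Possibility

instance : Zero Possibility := ⟨false⟩

instance : One Possibility := ⟨true⟩

instance : Add Possibility := ⟨Bool.or⟩

instance : Mul Possibility := ⟨Bool.and⟩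

instance : CommSemiring Possibility where
  nsmul := nsmulRec
  npow := npowRec
  add_assoc := Bool.or_assoc
  zero_add := Bool.false_or
  add_zero := Bool.or_false
  add_comm := Bool.or_comm
  mul_assoc := Bool.and_assoc
  one_mul := Bool.true_and
  mul_one := Bool.and_true
  mul_comm := Bool.and_comm
  left_distrib := Bool.and_or_distrib_left
  right_distrib := Bool.and_or_distrib_right
  zero_mul := Bool.false_and
  mul_zero := Bool.and_false

end Possibility

open Classical in
/-- The semiring homomorphism from the non-negative reals to the booleans which sends `0` to `0`
and every non-zero real to `1`. -/
def possibilityHom : ℝ≥0 →+* Possibility where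
  toFun x := if x = 0 then 0 else 1
  map_zero' := if_pos rfl
  map_one' := if_neg one_ne_zero
  map_add' x y := by
    by_cases hx : x = 0 <;> by_cases hy : y = 0 <;> simp [hx, hy] <;> rfl
  map_mul' x y := by
    by_cases hx : x = 0 <;> by_cases hy : y = 0 <;> simp [hx, hy]

/-! ## Measurement scenarios and empirical models -/

/-- A cover of the set `X` of measurements by measurement contexts, i.e. by sets of mutually
compatible measurements. -/
structure MeasurementScenario (X : Type*) where
  contexts : Set (Finset X)
  cover : ∀ x : X, ∃ C ∈ contexts, x ∈ C

/-- Sections over `U`: joint outcomes (all measurements having outcome set `O`) of the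
measurements in `U`. -/
abbrev Sections {X : Type*} (O : Type*) (U : Finset X) : Type _ := {x // x ∈ U} → O

/-- The restriction map of the presheaf of events. -/
def Sections.restrict {X O : Type*} {U V : Finset X} (h : V ⊆ U) (s : Sections O U) :
    Sections O V :=
  fun x => s ⟨x.1, h x.2⟩

/-- A (no-signalling) empirical model over the semiring `R`: a family of `R`-distributions on the
joint outcomes of each measurement context, with equal marginals on intersections of contexts. -/
structure EmpiricalModel (R : Type*) [CommSemiring R] {X : Type*} [DecidableEq X]
    (S : MeasurementScenario X) (O : Type*) where
  dist : ∀ C ∈ S.contexts, RDist R (Sections O C)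
  compatible : ∀ (C : Finset X) (hC : C ∈ S.contexts) (D : Finset X) (hD : D ∈ S.contexts),
    (dist C hC).map (Sections.restrict (Finset.inter_subset_left : C ∩ D ⊆ C)) =
      (dist D hD).map (Sections.restrict (Finset.inter_subset_right : C ∩ D ⊆ D))

namespace EmpiricalModel

variable {R R' : Type*} [CommSemiring R] [CommSemiring R'] {X : Type*} [DecidableEq X]
  {S : MeasurementScenario X} {O O' : Type*}

/-- The empirical model `(r ∘ ζ_C)` over another semiring. -/
def changeSemiring (r : R →+* R') (ζ : EmpiricalModel R S O) : EmpiricalModel R' S O where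
  dist C hC := (ζ.dist C hC).changeSemiring r
  compatible C hC D hD := by
    rw [← RDist.changeSemiring_map, ← RDist.changeSemiring_map, ζ.compatible C hC D hD]

/-- The possibilistic empirical model associated with a probabilistic one. -/
def possibilistic (ζ : EmpiricalModel ℝ≥0 S O) : EmpiricalModel Possibility S O :=
  ζ.changeSemiring possibilityHom

/-- The empirical model obtained by replacing each outcome `o` of each measurement `x` with the
label `e x o`. -/
def relabel (e : X → O → O') (ζ : EmpiricalModel R S O) : EmpiricalModel R S O' where
  dist C hC := (ζ.dist C hC).map fun s x => e x.1 (s x)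
  compatible C hC D hD := by
    have h := congrArg (RDist.map fun (s : Sections O (C ∩ D)) x => e x.1 (s x))
      (ζ.compatible C hC D hD)
    rw [RDist.map_map, RDist.map_map] at h
    rw [RDist.map_map, RDist.map_map]
    exact h

/-- The support subpresheaf of a possibilistic empirical model: the sections over `U` whose
restriction to `C ∩ U` is in the support of the marginal of `ζ_C` on `C ∩ U`, for all contexts
`C`. -/
def supportSubpresheaf (ζ : EmpiricalModel Possibility S O) (U : Finset X) :
    Set (Sections O U) :=
  {s | ∀ (C : Finset X) (hC : C ∈ S.contexts),
    s.restrict (Finset.inter_subset_right : C ∩ U ⊆ U) ∈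
      ((ζ.dist C hC).map
        (Sections.restrict (Finset.inter_subset_left : C ∩ U ⊆ C))).support}

end EmpiricalModel

/-! ## All-vs-Nothing models -/

/-- `𝓡`-linear equations `∑ x ∈ C, n x • s x = b` valued in the `𝓡`-module `G`, with index set
`C`. -/
structure LinearEquation (𝓡 G : Type*) {X : Type*} (C : Finset X) where
  coeff : {x // x ∈ C} → 𝓡
  rhs : G

/-- The assignment `s : C → G` satisfies the equation `φ`. -/
def LinearEquation.SatisfiedBy {𝓡 G X : Type*} [CommRing 𝓡] [AddCommGroup G] [Module 𝓡 G]
    {C : Finset X} (φ : LinearEquation 𝓡 G C) (s : Sections G C) : Prop :=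
  ∑ x : {x // x ∈ C}, φ.coeff x • s x = φ.rhs

/-- The set of all `𝓡`-linear equations satisfied by all the assignments in `W`. -/
def linearTheory (𝓡 : Type*) {G X : Type*} [CommRing 𝓡] [AddCommGroup G] [Module 𝓡 G]
    {C : Finset X} (W : Set (Sections G C)) : Set (LinearEquation 𝓡 G C) :=
  {φ | ∀ s ∈ W, φ.SatisfiedBy s}

namespace EmpiricalModel

variable {X : Type*} [DecidableEq X] {S : MeasurementScenario X}

/-- A possibilistic empirical model with outcomes in the `𝓡`-module `G` is All-vs-Nothing with
respect to `𝓡` and `G` iff its `𝓡`-linear theory has no solution in `G`. -/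
def IsPossibilisticAvN (𝓡 : Type*) {G : Type*} [CommRing 𝓡] [AddCommGroup G] [Module 𝓡 G]
    (ζ : EmpiricalModel Possibility S G) : Prop :=
  ¬ ∃ s : X → G, ∀ C ∈ S.contexts, ∀ φ ∈ linearTheory 𝓡 (ζ.supportSubpresheaf C),
    φ.SatisfiedBy fun x => s x.1

/-- A probabilistic empirical model is All-vs-Nothing iff the associated possibilistic model is. -/
def IsAvN (𝓡 : Type*) {G : Type*} [CommRing 𝓡] [AddCommGroup G] [Module 𝓡 G]
    (ζ : EmpiricalModel ℝ≥0 S G) : Prop :=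
  ζ.possibilistic.IsPossibilisticAvN 𝓡

end EmpiricalModel

/-- The unique `ℤ/m`-module structure on an abelian group whose exponent divides `m`. -/
abbrev zmodModuleOfExponent (m : ℕ) {K : Type*} [AddCommGroup K]
    (h : AddMonoid.exponent K ∣ m) : Module (ZMod m) K :=
  AddCommGroup.zmodModule (AddMonoid.exponent_dvd_iff_forall_nsmul_eq_zero.mp h)

/-! ## Quantum realisability -/

/-- The context of a Bell-type scenario in which party `j` chooses the measurement `m j`. -/
def bellContext {N : ℕ} {M : Fin N → Type*} (m : ∀ j, M j) : Finset (Σ j, M j) :=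
  Finset.univ.map ⟨fun j => ⟨j, m j⟩, fun _ _ h => congrArg Sigma.fst h⟩

theorem mem_bellContext {N : ℕ} {M : Fin N → Type*} (m : ∀ j, M j) (j : Fin N) :
    (⟨j, m j⟩ : Σ j, M j) ∈ bellContext m :=
  Finset.mem_map.mpr ⟨j, Finset.mem_univ j, rfl⟩

/-- The tensor product of the operators `A j`, one for each party, as a matrix in the product
basis. -/
def tensorMatrix {N : ℕ} {d : Fin N → ℕ} (A : ∀ j, Matrix (Fin (d j)) (Fin (d j)) ℂ) :
    Matrix (∀ j, Fin (d j)) (∀ j, Fin (d j)) ℂ :=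
  fun a b => ∏ j, A j (a j) (b j)

/-- A probabilistic empirical model is quantum realisable iff it is of Bell type (`N` parties,
party `j` with the set `M j` of measurement choices, each context consisting of exactly one choice
for each party) and there are finite-dimensional quantum systems `ℂ ^ d j`, one for each party, a
density matrix `ρ` of the joint system, and for each choice of each party a measurement (POVM) on
the system of that party, such that the probabilities of the model are given by the Born rule. -/
def EmpiricalModel.QuantumRealisable {N : ℕ} {M : Fin N → Type*} [DecidableEq (Σ j, M j)]
    {O : Type*} [Fintype O] {S : MeasurementScenario (Σ j, M j)}
    (ζ : EmpiricalModel ℝ≥0 S O) : Prop :=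
  (∀ C ∈ S.contexts, ∃ m : ∀ j, M j, C = bellContext m) ∧
  ∃ (d : Fin N → ℕ) (ρ : Matrix (∀ j, Fin (d j)) (∀ j, Fin (d j)) ℂ)
    (E : ∀ j, M j → O → Matrix (Fin (d j)) (Fin (d j)) ℂ),
    ρ.PosSemidef ∧ ρ.trace = 1 ∧
    (∀ j a o, (E j a o).PosSemidef) ∧ (∀ j a, ∑ o, E j a o = 1) ∧
    ∀ (m : ∀ j, M j) (hm : bellContext m ∈ S.contexts) (s : Sections O (bellContext m)),
      (((ζ.dist _ hm).weight s : ℝ) : ℂ) =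
        (ρ * tensorMatrix fun j => E j (m j) (s ⟨⟨j, m j⟩, mem_bellContext m j⟩)).trace

end

/-! ### Supports of push-forwards and of the possibilistic collapse. -/

noncomputable section

/-! The witness is a Mermin-type GHZ model: `n + 1` parties, dimension `n`, two Fourier-type
measurements each, the second twisted by the phase `ghzPhase`, of order `n ^ 2`. If a multiple `n *
z` of `n` parties choose `1`, their phases combine into a character value, so the outcomes are
uniform on tuples with sum `-z` (`ghz_bornRule`). Hence the sum is `0` when all choose `0`, and `-1`
when all but one choose `1`.

AvN: add the `n + 1` equations of the latter kind. Each `s i 1` occurs `n` times and vanishes mod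
`n`, leaving `∑ s i 0 = -1`, against `∑ s i 0 = 0` (`ghzModel_isAvN`).

Not AvN elsewhere: an equation on a relabelled context says that `∑ F i (t i)` is constant on tuples
of fixed sum. With three or more parties, each `F i` is then a constant plus a homomorphism from
`ZMod n`, and the latter is trivial if `G` has no `n`-torsion (`const_of_sum_eq_of_torsionFree`). No
equation depends on the outcomes, so any assignment of labels solves them all. -/

/-- Non-negative weights cannot cancel in a sum. -/
theorem RDist.support_map {α β : Type*} (f : α → β) (d : RDist ℝ≥0 α) :
    (d.map f).support = f '' d.support := by
  classical
  ext b
  simp only [RDist.support, RDist.map, Finsupp.mapDomain, Finsupp.sum, Finsupp.finsetSum_apply,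
    Set.mem_ofPred_eq, Set.mem_image, ne_eq, Finset.sum_eq_zero_iff, Finsupp.single_apply]
  push Not
  constructor
  · rintro ⟨a, ha, h⟩
    refine ⟨a, Finsupp.mem_support_iff.mp ha, ?_⟩
    by_contra hne
    exact h (if_neg hne)
  · rintro ⟨a, ha, rfl⟩
    exact ⟨a, Finsupp.mem_support_iff.mpr ha, by simpa using ha⟩

theorem possibilityHom_eq_zero_iff (x : ℝ≥0) : possibilityHom x = 0 ↔ x = 0 := by
  classical
  change (if x = 0 then (0 : Possibility) else 1) = 0 ↔ x = 0
  have h10 : (1 : Possibility) ≠ 0 := Bool.noConfusion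
  by_cases hx : x = 0 <;> simp [hx, h10]

theorem RDist.support_changeSemiring_possibilityHom {α : Type*} (d : RDist ℝ≥0 α) :
    (d.changeSemiring possibilityHom).support = d.support := by
  ext a
  simp [RDist.support, RDist.changeSemiring, possibilityHom_eq_zero_iff]

namespace EmpiricalModel

variable {X : Type*} [DecidableEq X] {S : MeasurementScenario X} {O : Type*}

/-- Over a context, the support subpresheaf is the support of the distribution. -/
theorem supportSubpresheaf_possibilistic (ζ : EmpiricalModel ℝ≥0 S O) {C : Finset X}
    (hC : C ∈ S.contexts) :
    ζ.possibilistic.supportSubpresheaf C = (ζ.dist C hC).support := by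
  ext s
  -- By no-signalling, every marginal on `D ∩ C` can be computed from `ζ_C`; the case `D = C` then
  -- recovers its whole support.
  have key : ∀ (D : Finset X) (hD : D ∈ S.contexts),
      ((ζ.possibilistic.dist D hD).map
        (Sections.restrict (Finset.inter_subset_left : D ∩ C ⊆ D))).support =
      Sections.restrict (Finset.inter_subset_right : D ∩ C ⊆ C) '' (ζ.dist C hC).support := by
    intro D hD
    change (((ζ.dist D hD).changeSemiring possibilityHom).map _).support = _
    rw [← RDist.changeSemiring_map, RDist.support_changeSemiring_possibilityHom,
      ζ.compatible D hD C hC, RDist.support_map]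
  constructor
  · intro hs
    have h := hs C hC
    rw [key C hC] at h
    obtain ⟨t, ht, hts⟩ := h
    have : t = s := by
      funext x
      exact congrFun hts ⟨x.1, Finset.mem_inter.mpr ⟨x.2, x.2⟩⟩
    exact this ▸ ht
  · intro hs D hD
    rw [key D hD]
    exact ⟨s, hs, rfl⟩

theorem isAvN_iff (𝓡 : Type*) {G : Type*} [CommRing 𝓡] [AddCommGroup G] [Module 𝓡 G]
    (ζ : EmpiricalModel ℝ≥0 S G) :
    ζ.IsAvN 𝓡 ↔ ¬ ∃ s : X → G, ∀ (C) (hC : C ∈ S.contexts) (φ : LinearEquation 𝓡 G C),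
      (∀ t ∈ (ζ.dist C hC).support, φ.SatisfiedBy t) → φ.SatisfiedBy fun x => s x.1 := by
  unfold IsAvN IsPossibilisticAvN
  refine not_congr (exists_congr fun s => forall_congr' fun C => forall_congr' fun hC => ?_)
  rw [supportSubpresheaf_possibilistic ζ hC]
  rfl

end EmpiricalModel

/-! ## Contexts of Bell-type scenarios -/

section BellContext

variable {N : ℕ} {M : Fin N → Type*}

theorem mem_bellContext_iff (m : ∀ j, M j) (x : Σ j, M j) :
    x ∈ bellContext m ↔ m x.1 = x.2 := by
  obtain ⟨j, a⟩ := x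
  simp only [bellContext, Finset.mem_map, Finset.mem_univ, true_and]
  constructor
  · rintro ⟨i, hi⟩
    cases hi
    rfl
  · rintro rfl
    exact ⟨j, rfl⟩

theorem bellContext_injective : Function.Injective (bellContext (M := M)) := by
  intro m m' h
  funext j
  have := mem_bellContext m j
  rw [h, mem_bellContext_iff] at this
  exact this.symm

/-- The measurements of a Bell-type context are indexed by the parties. -/
def bellContextEquiv (m : ∀ j, M j) : Fin N ≃ {x // x ∈ bellContext m} where
  toFun j := ⟨⟨j, m j⟩, mem_bellContext m j⟩
  invFun x := x.1.1
  left_inv _ := rfl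
  right_inv x := Subtype.ext (Sigma.ext rfl (heq_of_eq ((mem_bellContext_iff m x.1).mp x.2)))

theorem sum_bellContext {A : Type*} [AddCommMonoid A] (m : ∀ j, M j)
    (g : {x // x ∈ bellContext m} → A) :
    ∑ x, g x = ∑ j, g ⟨⟨j, m j⟩, mem_bellContext m j⟩ :=
  ((bellContextEquiv m).sum_comp g).symm

/-- The joint outcome of the measurements in `U` when party `j` obtains `t j`, whatever it
measures. -/
def partySection {O : Type*} (U : Finset (Σ j, M j)) (t : Fin N → O) : Sections O U :=
  fun x => t x.1.1

theorem partySection_bellContext_injective {O : Type*} (m : ∀ j, M j) :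
    Function.Injective (partySection (O := O) (bellContext m)) := fun _ _ h =>
  funext fun j => congrFun h ⟨⟨j, m j⟩, mem_bellContext m j⟩

theorem partySection_bellContext_surjective {O : Type*} (m : ∀ j, M j)
    (s : Sections O (bellContext m)) :
    partySection (bellContext m) (fun j => s ⟨⟨j, m j⟩, mem_bellContext m j⟩) = s :=
  funext fun x => congrArg s ((bellContextEquiv m).apply_symm_apply x)

end BellContext

/-! ## Uniform distributions on the tuples with a given sum -/

section ParityDist

variable {n : ℕ} [NeZero n]

/-- Any choice of the last `N` coordinates determines the first. -/
theorem sum_parity_indicator (n N : ℕ) [NeZero n] (c : ZMod n) (w : ℝ≥0) :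
    (∑ t : Fin (N + 1) → ZMod n, if ∑ j, t j = c then w else 0) = (n : ℝ≥0) ^ N * w := by
  rw [← (Fin.consEquiv fun _ : Fin (N + 1) => ZMod n).sum_comp, Fintype.sum_prod_type,
    Finset.sum_comm]
  have : ∀ t : Fin N → ZMod n,
      (∑ x : ZMod n, if ∑ j, (Fin.consEquiv fun _ : Fin (N + 1) => ZMod n) (x, t) j = c
        then w else 0) = w := by
    intro t
    simp_rw [Fin.consEquiv_apply, Fin.sum_univ_succ, Fin.cons_zero, Fin.cons_succ,
      ← eq_sub_iff_add_eq]
    simp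
  rw [Finset.sum_congr rfl fun t _ => this t]
  simp [ZMod.card]

/-- The uniform distribution on the `N + 1`-tuples of integers modulo `n` with sum `c`. -/
def parityDist (n N : ℕ) [NeZero n] (c : ZMod n) : RDist ℝ≥0 (Fin (N + 1) → ZMod n) where
  weight := Finsupp.equivFunOnFinite.symm
    fun t => if ∑ j, t j = c then ((n : ℝ≥0) ^ N)⁻¹ else 0
  total := by
    rw [Finsupp.sum_fintype _ _ fun _ => rfl]
    simp only [Finsupp.equivFunOnFinite_symm_apply_apply]
    rw [sum_parity_indicator, mul_inv_cancel₀]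
    exact pow_ne_zero _ (Nat.cast_ne_zero.mpr (NeZero.ne n))

theorem parityDist_weight (N : ℕ) (c : ZMod n) (t : Fin (N + 1) → ZMod n) :
    (parityDist n N c).weight t = if ∑ j, t j = c then ((n : ℝ≥0) ^ N)⁻¹ else 0 := rfl

theorem mem_support_parityDist (N : ℕ) (c : ZMod n) (t : Fin (N + 1) → ZMod n) :
    t ∈ (parityDist n N c).support ↔ ∑ j, t j = c := by
  simp [RDist.support, parityDist_weight, NeZero.ne n]

theorem parityDist_map_add_single (N : ℕ) (c d : ZMod n) (j : Fin (N + 1)) :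
    (parityDist n N c).map (fun t => t + Pi.single j d) = parityDist n N (c + d) := by
  refine RDist.ext (Finsupp.ext fun t => ?_)
  change (Finsupp.mapDomain (Equiv.addRight (Pi.single j d)) (parityDist n N c).weight) t = _
  rw [Finsupp.mapDomain_equiv_apply, parityDist_weight, parityDist_weight]
  have h : ∑ i, (Equiv.addRight (Pi.single j d)).symm t i = ∑ i, t i - d := by
    simp [← sub_eq_add_neg, Finset.sum_sub_distrib]
  simp only [h, sub_eq_iff_eq_add]

/-- Shifting coordinate `j` by `c' - c` carries one distribution to the other and is invisible on
`U`. This gives no-signalling: distinct contexts differ at some party. -/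
theorem parityDist_map_partySection {N : ℕ} {M : Fin (N + 1) → Type*} (c c' : ZMod n)
    (U : Finset (Σ j, M j)) (j : Fin (N + 1)) (hj : ∀ x ∈ U, x.1 ≠ j) :
    (parityDist n N c).map (partySection U) = (parityDist n N c').map (partySection U) := by
  rw [← add_sub_cancel c c', ← parityDist_map_add_single N c (c' - c) j, RDist.map_map]
  congr 1
  funext t x
  simp [partySection, Pi.single_eq_of_ne (hj x.1 x.2)]

end ParityDist

/-! ## The model -/

/-- Party `j` chooses its measurement `0`, all others choose their measurement `1`. -/
def oneZeroSetting {N : ℕ} (j : Fin N) : Fin N → Fin 2 := fun i => if i = j then 0 else 1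

/-- The scenario with two measurements for each party whose contexts are the choice of
measurement `0` by all parties, and the choices of measurement `0` by exactly one party. -/
def ghzScenario (n : ℕ) [NeZero n] : MeasurementScenario (Σ _ : Fin (n + 1), Fin 2) where
  contexts := insert (bellContext fun _ => 0)
    (Set.range fun j => bellContext (oneZeroSetting j))
  cover := by
    rintro ⟨j, a⟩
    by_cases ha : a = 0
    · exact ⟨_, Or.inl rfl, (mem_bellContext_iff _ _).mpr ha.symm⟩
    · have : Nontrivial (Fin (n + 1)) :=
        ⟨0, Fin.last n, fun h => NeZero.ne n (congrArg Fin.val h).symm⟩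
      obtain ⟨i, hi⟩ := exists_ne j
      refine ⟨_, Or.inr ⟨i, rfl⟩, (mem_bellContext_iff _ _).mpr ?_⟩
      simp only [oneZeroSetting, if_neg hi.symm]
      omega

section GHZModel

variable {n : ℕ} [NeZero n]

theorem exists_eq_bellContext_of_mem_ghzScenario {C : Finset (Σ _ : Fin (n + 1), Fin 2)}
    (hC : C ∈ (ghzScenario n).contexts) :
    ∃ f : Fin (n + 1) → Fin 2, C = bellContext f := by
  rcases hC with h | ⟨j, h⟩
  exacts [⟨_, h⟩, ⟨_, h.symm⟩]

/-- The prescribed sum of the outcomes in each context. -/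
def ghzParity (n : ℕ) (C : Finset (Σ _ : Fin (n + 1), Fin 2)) : ZMod n :=
  if C = bellContext fun _ => 0 then 0 else -1

theorem ghzParity_oneZeroSetting (j : Fin (n + 1)) :
    ghzParity n (bellContext (oneZeroSetting j)) = -1 := by
  refine if_neg fun h => ?_
  have : Nontrivial (Fin (n + 1)) :=
    ⟨0, Fin.last n, fun h => NeZero.ne n (congrArg Fin.val h).symm⟩
  obtain ⟨i, hi⟩ := exists_ne j
  have := congrFun (bellContext_injective h) i
  simp [oneZeroSetting, hi] at this

/-- The model in which the outcomes in each context are uniformly distributed on the tuples with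
the prescribed sum. -/
def ghzModel (n : ℕ) [NeZero n] : EmpiricalModel ℝ≥0 (ghzScenario n) (ZMod n) where
  dist C _ := (parityDist n n (ghzParity n C)).map (partySection C)
  compatible C hC D hD := by
    by_cases hCD : C = D
    · subst hCD
      rfl
    obtain ⟨f, rfl⟩ := exists_eq_bellContext_of_mem_ghzScenario hC
    obtain ⟨g, rfl⟩ := exists_eq_bellContext_of_mem_ghzScenario hD
    obtain ⟨j, hj⟩ := Function.ne_iff.mp fun h : f = g => hCD (congrArg _ h)
    rw [RDist.map_map, RDist.map_map]
    refine parityDist_map_partySection _ _ _ j ?_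
    rintro ⟨i, a⟩ hx rfl
    rw [Finset.mem_inter, mem_bellContext_iff, mem_bellContext_iff] at hx
    exact hj (hx.1.trans hx.2.symm)

theorem support_ghzModel {C : Finset (Σ _ : Fin (n + 1), Fin 2)}
    (hC : C ∈ (ghzScenario n).contexts) :
    ((ghzModel n).dist C hC).support =
      partySection C '' {t | ∑ j, t j = ghzParity n C} := by
  change ((parityDist n n (ghzParity n C)).map (partySection C)).support = _
  rw [RDist.support_map]
  congr 1
  ext t
  exact mem_support_parityDist n _ t

theorem ghzModel_weight (f : Fin (n + 1) → Fin 2)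
    (hf : bellContext f ∈ (ghzScenario n).contexts) (s : Sections (ZMod n) (bellContext f)) :
    ((ghzModel n).dist _ hf).weight s =
      if ∑ j, s ⟨⟨j, f j⟩, mem_bellContext f j⟩ = ghzParity n (bellContext f)
        then ((n : ℝ≥0) ^ n)⁻¹ else 0 := by
  conv_lhs => rw [← partySection_bellContext_surjective f s]
  exact (Finsupp.mapDomain_apply (partySection_bellContext_injective f) _ _).trans
    (parityDist_weight _ _ _)

omit [NeZero n] in
-- Each `s i 0` is counted once and each `s i 1` is counted `n` times.
theorem sum_oneZeroSetting (s : Fin (n + 1) → Fin 2 → ZMod n) :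
    ∑ j, ∑ i, s i (oneZeroSetting j i) = ∑ i, s i 0 := by
  rw [Finset.sum_comm]
  refine Finset.sum_congr rfl fun i _ => ?_
  have h : ∀ j, s i (oneZeroSetting j i) = s i 1 + if i = j then s i 0 - s i 1 else 0 := by
    intro j
    by_cases hij : i = j <;> simp [oneZeroSetting, hij]
  simp [h, Finset.sum_add_distrib]

/-- Only equations with all coefficients `1` are used, so the ring is arbitrary. -/
theorem ghzModel_isAvN (hn : 2 ≤ n) (𝓡 : Type*) [CommRing 𝓡] [Module 𝓡 (ZMod n)] :
    (ghzModel n).IsAvN 𝓡 := by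
  rw [EmpiricalModel.isAvN_iff]
  rintro ⟨s, hs⟩
  have key : ∀ f : Fin (n + 1) → Fin 2, bellContext f ∈ (ghzScenario n).contexts →
      ∑ j, s ⟨j, f j⟩ = ghzParity n (bellContext f) := by
    intro f hf
    have := hs _ hf ⟨fun _ => 1, ghzParity n (bellContext f)⟩ ?_
    · simpa only [LinearEquation.SatisfiedBy, sum_bellContext, one_smul] using this
    · rw [support_ghzModel]
      rintro _ ⟨t, ht, rfl⟩
      simpa only [LinearEquation.SatisfiedBy, sum_bellContext, one_smul, partySection,
        Set.mem_ofPred_eq] using ht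
  have h0 : ∑ j, s ⟨j, 0⟩ = 0 := (key _ (Or.inl rfl)).trans (if_pos rfl)
  have h1 : ∀ j, ∑ i, s ⟨i, oneZeroSetting j i⟩ = -1 := fun j =>
    (key _ (Or.inr ⟨j, rfl⟩)).trans (ghzParity_oneZeroSetting j)
  have h2 := sum_oneZeroSetting fun i a => s ⟨i, a⟩
  -- The `n + 1` copies of `-1` add up to `-1`, which is non-zero as `n ≥ 2`.
  simp only [h1, h0] at h2
  have : Fact (1 < n) := ⟨hn⟩
  simp at h2

end GHZModel

/-! ## Relabellings in coprime torsion -/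

section Relabel

variable {n : ℕ} [NeZero n] {G : Type*} [AddCommGroup G]

omit [NeZero n] in
/-- If `∑ i, F i (t i)` depends only on `∑ i, t i`, and there are at least three summands, then
each `F i` is affine; so it is constant if there is no `n`-torsion. -/
theorem const_of_sum_eq_of_torsionFree (hG : ∀ g : G, n • g = 0 → g = 0) {ι : Type*} [Fintype ι]
    [DecidableEq ι] {i j l : ι} (hij : i ≠ j) (hil : i ≠ l) (hjl : j ≠ l)
    (F : ι → ZMod n → G) (c : ZMod n) (b : G)
    (h : ∀ t : ι → ZMod n, ∑ k, t k = c → ∑ k, F k (t k) = b) (x : ZMod n) :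
    F i x = F i 0 := by
  have key : ∀ x y x' y' : ZMod n, x + y = x' + y' → F i x + F j y = F i x' + F j y' := by
    intro x y x' y' hxy
    -- The third index `l` absorbs the remainder, so the total is `c`; tuples with equal `x + y`
    -- agree away from `i` and `j`.
    let T : ZMod n → ZMod n → ι → ZMod n := fun x y =>
      Pi.single i x + Pi.single j y + Pi.single l (c - (x + y))
    have hT : ∀ x y, ∑ k, F k (T x y k) = b := fun x y => h _ <| by
      simp [T, Finset.sum_add_distrib]
    have hsub : ∑ k, (F k (T x y k) - F k (T x' y' k)) = 0 := by
      rw [Finset.sum_sub_distrib, hT, hT, sub_self]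
    rw [Fintype.sum_eq_add i j hij] at hsub
    · have : ∀ x y, T x y i = x ∧ T x y j = y := fun x y => by
        simp [T, hij, hil, hjl, hij.symm]
      simp only [this] at hsub
      rw [← sub_eq_zero, ← hsub]
      abel
    · rintro k ⟨hki, hkj⟩
      simp [T, hki, hkj, hxy]
  -- Since `F j` differs from `F i` by a constant, `key` becomes additivity of `F i x - F i 0`.
  let D : ZMod n →+ G := AddMonoidHom.mk' (fun x => F i x - F i 0) fun x y => by
    have h1 := key x y (x + y) 0 (by simp)
    have h2 := key 0 y y 0 (by simp)
    have h3 : F j y = F i y + F j 0 - F i 0 := by rw [← h2]; abel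
    rw [h3] at h1
    have h4 : F i (x + y) = F i x + F i y - F i 0 := by
      rw [eq_sub_iff_add_eq, ← add_right_cancel_iff (a := F j 0), add_right_comm, ← h1]; abel
    rw [h4]; abel
  have hD : D x = 0 := hG _ <| by rw [← map_nsmul]; simp
  exact sub_eq_zero.mp hD

theorem ghzModel_relabel_not_isAvN (hn : 2 ≤ n) (𝓡 : Type*) [CommRing 𝓡] [Module 𝓡 G]
    (hG : ∀ g : G, n • g = 0 → g = 0) (e : (Σ _ : Fin (n + 1), Fin 2) → ZMod n → G) :
    ¬ ((ghzModel n).relabel e).IsAvN 𝓡 := by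
  rw [EmpiricalModel.isAvN_iff, not_not]
  -- The outcome `0` is an arbitrary choice: every term of every valid equation turns out constant.
  refine ⟨fun x => e x 0, fun C hC φ hφ => ?_⟩
  obtain ⟨f, rfl⟩ := exists_eq_bellContext_of_mem_ghzScenario hC
  obtain ⟨r, b⟩ := φ
  let F : Fin (n + 1) → ZMod n → G := fun j o =>
    r ⟨⟨j, f j⟩, mem_bellContext f j⟩ • e ⟨j, f j⟩ o
  have hF : ∀ t : Fin (n + 1) → ZMod n, ∑ k, t k = ghzParity n (bellContext f) →
      ∑ k, F k (t k) = b := by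
    intro t ht
    have := hφ (fun x => e x.1 (partySection (bellContext f) t x)) ?_
    · exact (sum_bellContext f _).symm.trans this
    · change _ ∈ (((ghzModel n).dist _ hC).map _).support
      rw [RDist.support_map, support_ghzModel]
      exact ⟨_, ⟨t, ht, rfl⟩, rfl⟩
  have hconst : ∀ i x, F i x = F i 0 := by
    intro i x
    -- Two further parties exist because `n + 1 ≥ 3`.
    obtain ⟨j, hj, l, hl, hjl⟩ := Finset.one_lt_card.mp
      (show 1 < (Finset.univ.erase i).card by simp; omega)
    exact const_of_sum_eq_of_torsionFree hG (Finset.ne_of_mem_erase hj).symm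
      (Finset.ne_of_mem_erase hl).symm hjl F _ b hF x
  -- Any tuple with the prescribed sum would do to evaluate `b`.
  have h0 := hF (Pi.single 0 (ghzParity n (bellContext f))) (by simp)
  rw [Finset.sum_congr rfl fun i _ => hconst i _] at h0
  exact (sum_bellContext f _).trans h0

theorem eq_zero_of_nsmul_eq_zero_of_coprime {m n : ℕ} (h : m.Coprime n) {g : G}
    (hm : m • g = 0) (hn : n • g = 0) : g = 0 := by
  have := Nat.dvd_gcd (addOrderOf_dvd_of_nsmul_eq_zero hm) (addOrderOf_dvd_of_nsmul_eq_zero hn)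
  rw [h.gcd_eq_one, Nat.dvd_one] at this
  exact AddMonoid.addOrderOf_eq_one_iff.mp this

end Relabel

/-! ## Quantum realisation -/

section Quantum

open Matrix

theorem tensorMatrix_vecMulVec {N : ℕ} {d : Fin N → ℕ} (v : ∀ j, Fin (d j) → ℂ) :
    tensorMatrix (fun j => vecMulVec (v j) (star (v j))) =
      vecMulVec (fun a : ∀ j, Fin (d j) => ∏ j, v j (a j)) (star fun a => ∏ j, v j (a j)) := by
  ext a b
  simp [tensorMatrix, vecMulVec_apply, Finset.prod_mul_distrib]

/-- The unnormalised state `∑ k, |k ⋯ k⟩` of `N` systems of dimension `n`. -/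
def ghzVector (N n : ℕ) : (Fin N → Fin n) → ℂ :=
  fun a => ∑ k : Fin n, if a = fun _ => k then 1 else 0

theorem ghzVector_dotProduct (N n : ℕ) (h : (Fin N → Fin n) → ℂ) :
    ghzVector N n ⬝ᵥ h = ∑ k : Fin n, h fun _ => k := by
  simp only [dotProduct, ghzVector, Finset.sum_mul]
  rw [Finset.sum_comm]
  simp

theorem star_ghzVector (N n : ℕ) : star (ghzVector N n) = ghzVector N n := by
  ext a
  simp [ghzVector]

theorem ghzVector_const (N n : ℕ) (k : Fin n) : ghzVector (N + 1) n (fun _ => k) = 1 := by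
  have : ∀ l : Fin n, ((fun _ : Fin (N + 1) => k) = fun _ => l) ↔ k = l := fun l =>
    ⟨fun h => congrFun h 0, fun h => h ▸ rfl⟩
  simp [ghzVector, this]

variable (n : ℕ)

/-- The density matrix of the generalised GHZ state of `n + 1` systems of dimension `n`. -/
def ghzState : Matrix (Fin (n + 1) → Fin n) (Fin (n + 1) → Fin n) ℂ :=
  ((n : ℂ))⁻¹ • vecMulVec (ghzVector (n + 1) n) (star (ghzVector (n + 1) n))

theorem inv_natCast_nonneg_complex : 0 ≤ ((n : ℂ))⁻¹ := by
  rw [← Complex.ofReal_natCast, ← Complex.ofReal_inv, Complex.zero_le_real]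
  positivity

theorem ghzState_posSemidef : (ghzState n).PosSemidef :=
  (posSemidef_vecMulVec_self_star _).smul (inv_natCast_nonneg_complex n)

variable [NeZero n]

theorem ghzState_trace : (ghzState n).trace = 1 := by
  rw [ghzState, trace_smul, trace_vecMulVec, star_ghzVector, ghzVector_dotProduct]
  simp [ghzVector_const, NeZero.ne n]

/-- A primitive root of unity of order `n ^ 2`. -/
def ghzPhase : ℂ := Complex.exp (2 * Real.pi * Complex.I / (n ^ 2 : ℕ))

theorem ghzPhase_pow : ghzPhase n ^ n = ZMod.stdAddChar (1 : ZMod n) := by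
  have hn : (n : ℂ) ≠ 0 := Nat.cast_ne_zero.mpr (NeZero.ne n)
  have := ZMod.stdAddChar_coe (N := n) 1
  rw [Int.cast_one] at this
  rw [this, ghzPhase, ← Complex.exp_nat_mul]
  congr 1
  push_cast
  field_simp

theorem ghzPhase_mul_star : ghzPhase n * star (ghzPhase n) = 1 := by
  have h : ghzPhase n ^ (n ^ 2) = 1 := by
    rw [pow_two, pow_mul, ghzPhase_pow, ← AddChar.map_nsmul_eq_pow]
    simp
  have := Complex.norm_eq_one_of_pow_eq_one h (pow_ne_zero 2 (NeZero.ne n))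
  rw [Complex.star_def, Complex.mul_conj, Complex.normSq_eq_norm_sq, this]
  simp

/-- The unnormalised eigenvector with outcome `o` of the measurement `a`. -/
def ghzEigenvector (a : Fin 2) (o : ZMod n) : Fin n → ℂ :=
  fun k => ZMod.stdAddChar (((k : ℕ) : ZMod n) * o) * ghzPhase n ^ ((k : ℕ) * (a : ℕ))

/-- The operator of the outcome `o` of the measurement `a`. -/
def ghzEffect (a : Fin 2) (o : ZMod n) : Matrix (Fin n) (Fin n) ℂ :=
  ((n : ℂ))⁻¹ • vecMulVec (ghzEigenvector n a o) (star (ghzEigenvector n a o))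

theorem ghzEffect_posSemidef (a : Fin 2) (o : ZMod n) : (ghzEffect n a o).PosSemidef :=
  (posSemidef_vecMulVec_self_star _).smul (inv_natCast_nonneg_complex n)

variable {n}

omit [NeZero n] in
theorem natCast_zmod_inj_of_lt (k l : Fin n) : ((k : ℕ) : ZMod n) = (l : ℕ) ↔ k = l := by
  rw [ZMod.natCast_eq_natCast_iff', Nat.mod_eq_of_lt k.2, Nat.mod_eq_of_lt l.2, Fin.val_inj]

theorem star_stdAddChar (x : ZMod n) :
    star (ZMod.stdAddChar x) = ZMod.stdAddChar (-x) := by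
  rw [AddChar.map_neg_eq_conj]
  rfl

theorem sum_stdAddChar_mul (x : ZMod n) :
    ∑ o : ZMod n, ZMod.stdAddChar (o * x) = if x = 0 then (n : ℂ) else 0 := by
  rw [AddChar.sum_mulShift x (ZMod.isPrimitive_stdAddChar n), ZMod.card]
  split_ifs <;> simp

/-- Character orthogonality kills the off-diagonal entries; on the diagonal the phases have modulus
one. -/
theorem sum_ghzEffect (a : Fin 2) : ∑ o, ghzEffect n a o = 1 := by
  have hn : (n : ℂ) ≠ 0 := Nat.cast_ne_zero.mpr (NeZero.ne n)
  ext k l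
  have h : ∀ o : ZMod n, ghzEffect n a o k l =
      (n : ℂ)⁻¹ * (ghzPhase n ^ ((k : ℕ) * (a : ℕ)) * star (ghzPhase n ^ ((l : ℕ) * (a : ℕ)))) *
        ZMod.stdAddChar (o * ((k : ℕ) - (l : ℕ) : ZMod n)) := by
    intro o
    have : ZMod.stdAddChar (o * ((k : ℕ) - (l : ℕ) : ZMod n)) =
        ZMod.stdAddChar (((k : ℕ) : ZMod n) * o) * star (ZMod.stdAddChar (((l : ℕ) : ZMod n) * o)) := by
      rw [star_stdAddChar, ← AddChar.map_add_eq_mul]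
      congr 1
      ring
    rw [this]
    simp only [ghzEffect, Matrix.smul_apply, vecMulVec_apply, ghzEigenvector, Pi.star_apply, star_mul,
      smul_eq_mul]
    ring
  rw [Matrix.sum_apply, Finset.sum_congr rfl fun o _ => h o, ← Finset.mul_sum,
    sum_stdAddChar_mul, Matrix.one_apply]
  simp only [sub_eq_zero, natCast_zmod_inj_of_lt]
  split_ifs with hkl
  · subst hkl
    rw [star_pow, ← mul_pow, ghzPhase_mul_star, one_pow]
    field_simp
  · simp

/-- The phases pool to `ghzPhase n ^ (n * z * k)`, a character value at `k * z`: the settings act as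
a shift of the outcome sum by `z`. -/
theorem prod_ghzEigenvector (f : Fin (n + 1) → Fin 2) (z : ℕ) (hf : ∑ j, (f j : ℕ) = n * z)
    (t : Fin (n + 1) → ZMod n) (k : Fin n) :
    ∏ j, ghzEigenvector n (f j) (t j) k =
      ZMod.stdAddChar (((k : ℕ) : ZMod n) * (∑ j, t j + (z : ZMod n))) := by
  have hprod : ∏ j, ZMod.stdAddChar (((k : ℕ) : ZMod n) * t j) =
      ZMod.stdAddChar (∑ j, ((k : ℕ) : ZMod n) * t j) :=
    (map_prod (ZMod.stdAddChar (N := n)).toMonoidHom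
      (fun j => Multiplicative.ofAdd (((k : ℕ) : ZMod n) * t j)) Finset.univ).symm
  simp only [ghzEigenvector]
  rw [Finset.prod_mul_distrib, Finset.prod_pow_eq_pow_sum, ← Finset.mul_sum, hf, hprod,
    ← Finset.mul_sum, mul_left_comm, pow_mul, ghzPhase_pow,
    ← AddChar.map_nsmul_eq_pow, ← AddChar.map_add_eq_mul]
  congr 1
  simp
  ring

/-- State and effect have rank one, so the trace is a squared overlap. The overlap is a full
character sum, equal to `n` or `0`; the scalars give `n⁻¹ * n⁻¹ ^ (n + 1) * n ^ 2 = (n ^ n)⁻¹`. -/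
theorem ghz_bornRule (f : Fin (n + 1) → Fin 2) (z : ℕ) (hf : ∑ j, (f j : ℕ) = n * z)
    (t : Fin (n + 1) → ZMod n) :
    (ghzState n * tensorMatrix (d := fun _ => n) fun j => ghzEffect n (f j) (t j)).trace =
      if ∑ j, t j = -z then ((n : ℂ) ^ n)⁻¹ else 0 := by
  have hn : (n : ℂ) ≠ 0 := Nat.cast_ne_zero.mpr (NeZero.ne n)
  have hT : (tensorMatrix (d := fun _ => n) fun j => ghzEffect n (f j) (t j)) = ((n : ℂ)⁻¹) ^ (n + 1) •
      tensorMatrix (d := fun _ => n) fun j => vecMulVec (ghzEigenvector n (f j) (t j))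
        (star (ghzEigenvector n (f j) (t j))) := by
    ext a b
    simp [tensorMatrix, ghzEffect, Finset.prod_mul_distrib]
  have hV : (ghzVector (n + 1) n ⬝ᵥ fun a => ∏ j, ghzEigenvector n (f j) (t j) (a j)) =
      if ∑ j, t j = -z then (n : ℂ) else 0 := by
    rw [ghzVector_dotProduct]
    simp only [prod_ghzEigenvector f z hf]
    have hbij : Function.Bijective fun k : Fin n => ((k : ℕ) : ZMod n) :=
      (Fintype.bijective_iff_injective_and_card _).mpr
        ⟨fun k l => (natCast_zmod_inj_of_lt k l).mp, by simp [ZMod.card]⟩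
    rw [hbij.sum_comp fun x => ZMod.stdAddChar (x * (∑ j, t j + z : ZMod n)),
      sum_stdAddChar_mul]
    simp only [← eq_neg_iff_add_eq_zero]
  have hV' : (ghzVector (n + 1) n ⬝ᵥ star fun a => ∏ j, ghzEigenvector n (f j) (t j) (a j)) =
      if ∑ j, t j = -z then (n : ℂ) else 0 := by
    rw [dotProduct_star, star_ghzVector, dotProduct_comm, hV]
    split_ifs <;> simp
  rw [hT, tensorMatrix_vecMulVec, ghzState, smul_mul_smul_comm, vecMulVec_mul_vecMulVec]
  refine (trace_smul _ _).trans ?_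
  rw [trace_vecMulVec, dotProduct_smul, star_ghzVector, hV, hV']
  split_ifs
  · simp only [smul_eq_mul, pow_succ, inv_pow]
    field_simp
  · simp

theorem ghzModel_quantumRealisable : (ghzModel n).QuantumRealisable := by
  refine ⟨fun C hC => exists_eq_bellContext_of_mem_ghzScenario hC, fun _ => n, ghzState n,
    fun _ a o => ghzEffect n a o, ghzState_posSemidef n, ghzState_trace n,
    fun _ a o => ghzEffect_posSemidef n a o, fun _ a => sum_ghzEffect a, fun f hf s => ?_⟩
  -- Either no party or exactly `n` parties choose `1`, so `z` is `0` or `1`.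
  obtain ⟨z, hz, hp⟩ : ∃ z : ℕ, ∑ j, (f j : ℕ) = n * z ∧
      ghzParity n (bellContext f) = -z := by
    rcases hf with h | ⟨j, h⟩
    · obtain rfl := bellContext_injective h
      exact ⟨0, by simp, by simp [ghzParity]⟩
    · obtain rfl := bellContext_injective h
      refine ⟨1, ?_, by rw [ghzParity_oneZeroSetting]; simp⟩
      have : ∀ i, ((oneZeroSetting j i : Fin 2) : ℕ) = if i = j then 0 else 1 := fun i => by
        by_cases h : i = j <;> simp [oneZeroSetting, h]
      simp [this, Finset.sum_ite, Finset.filter_ne']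
  rw [ghzModel_weight, ghz_bornRule f z hz, hp]
  split_ifs <;> simp

end Quantum

end

theorem mainTheorem4 (n : ℕ) [NeZero n] (hn : 2 ≤ n) :
    ∃ (N : ℕ) (k : Fin N → ℕ) (S : MeasurementScenario (Σ j, Fin (k j)))
      (ζ : EmpiricalModel ℝ≥0 S (ZMod n)),
      ζ.QuantumRealisable ∧
      ζ.IsAvN (ZMod n) ∧
      ζ.IsAvN ℤ ∧
      (∀ (m : ℕ), 2 ≤ m → m.Coprime n →
        ∀ (K : Type*) [AddCommGroup K] [Nontrivial K] (hK : AddMonoid.exponent K ∣ m)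
          (e : (Σ j, Fin (k j)) → ZMod n → K),
          letI : Module (ZMod m) K := zmodModuleOfExponent m hK
          ¬ (ζ.relabel e).IsAvN (ZMod m)) ∧
      (∀ (m : ℕ), 2 ≤ m → m.Coprime n →
        ∀ e : (Σ j, Fin (k j)) → ZMod n → ZMod m, ¬ (ζ.relabel e).IsAvN (ZMod m)) := by
  refine ⟨n + 1, fun _ => 2, ghzScenario n, ghzModel n, ghzModel_quantumRealisable,
    ghzModel_isAvN hn _, ghzModel_isAvN hn _, ?_, ?_⟩
  · intro m _ hmn K _ _ hK e
    let : Module (ZMod m) K := zmodModuleOfExponent m hK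
    refine ghzModel_relabel_not_isAvN hn (ZMod m) (fun g hg => ?_) e
    exact eq_zero_of_nsmul_eq_zero_of_coprime hmn
      (AddMonoid.exponent_dvd_iff_forall_nsmul_eq_zero.mp hK g) hg
  · intro m _ hmn e
    refine ghzModel_relabel_not_isAvN hn (ZMod m) (fun g hg => ?_) e
    exact eq_zero_of_nsmul_eq_zero_of_coprime hmn (by simp) hg
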